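/- Let $\Gamma$ be a finite digraph without loops (and without multiple arcs) with vertex set $V$. A path of length $r$ from $x$ to $y$ is a sequence $(x=w_0,w_1,\ldots,w_r=y)$ of vertices such that each $(w_{t-1},w_t)$ is an arc. Suppose that $\Gamma$ is strongly connected, let $\partial(x,y)$ be the length of a shortest path from $x$ to $y$, let $\tilde\partial(x,y)=(\partial(x,y),\partial(y,x))$ be the two-way distance and $\tilde\partial(\Gamma)=\{\tilde\partial(x,y): x,y\in V\}$. For $\tilde i\in\tilde\partial(\Gamma)$ let $\Gamma_{\tilde i}=\{(x,y)\in V\times V:\tilde\partial(x,y)=\tilde i\}$. Suppose that $\Gamma$ is a commutative weakly distance-regular digraph, that is, the relations $\Gamma_{\tilde i}$, $\tilde i\in\tilde\partial(\Gamma)$, form a non-symmetric commutative association scheme on $V$: for all $\tilde i,\tilde j,\tilde l\in\tilde\partial(\Gamma)$ the number of $z\in V$ with $(x,z)\in\Gamma_{\tilde i}$ and $(z,y)\in\Gamma_{\tilde j}$ is the same number $p_{\tilde i,\tilde j}^{\tilde l}$ for all $(x,y)\in\Gamma_{\tilde l}$, one has $p_{\tilde i,\tilde j}^{\tilde l}=p_{\tilde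 j,\tilde i}^{\tilde l}$, and not all of the relations $\Gamma_{\tilde i}$ are symmetric. Suppose also that $\Gamma$ is semicomplete multipartite, that is, its underlying graph (in which distinct $x,y$ are joined whenever $(x,y)$ or $(y,x)$ is an arc) is a complete multipartite graph $K_{n_1,\ldots,n_m}$ with $m\ge 2$ parts and all part sizes $n_1,\ldots,n_m\ge 2$. Let $T=\{q : (1,q-1)\in\tilde\partial(\Gamma)\}$. Then $$T=\{3\},\quad T=\{4\},\quad T=\{3,4\}\quad\text{or}\quad T=\{2,3\}.$$ In particular, $T\neq\{2,4\}$ and $T\neq\{2,3,4\}$. -/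

import Mathlib

namespace Digraph

variable {V : Type*}

/-- There is a path `(x = w 0, w 1, …, w r = y)` of length `r` from `x` to `y` in `G`
(only the values `w 0, …, w r` matter; vertices may repeat). -/
def HasPath (G : Digraph V) (r : ℕ) (x y : V) : Prop :=
  ∃ w : ℕ → V, w 0 = x ∧ w r = y ∧ ∀ t < r, G.Adj (w t) (w (t + 1))

/-- Any vertex can be reached from any vertex. -/
def StronglyConnected (G : Digraph V) : Prop :=
  ∀ x y, ∃ r, G.HasPath r x y

/-- The length of a shortest path from `x` to `y`. It is only used for strongly connected digraphs,
where such a path exists; otherwise the value is `0` when there is none. -/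
noncomputable def dist (G : Digraph V) (x y : V) : ℕ :=
  sInf {r | G.HasPath r x y}

/-- The two-way distance from `x` to `y`. -/
noncomputable def twoWayDist (G : Digraph V) (x y : V) : ℕ × ℕ :=
  (G.dist x y, G.dist y x)

/-- The two-way distance set of `G`. -/
def twoWayDistSet (G : Digraph V) : Set (ℕ × ℕ) :=
  {i | ∃ x y, G.twoWayDist x y = i}

/-- The relations of pairs of vertices at a given two-way distance,
indexed by the two-way distance set. -/
def twoWayRel (G : Digraph V) (i : G.twoWayDistSet) : Set (V × V) :=
  {p | G.twoWayDist p.1 p.2 = i}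

/-- The set `T` of the integers `q = r + 1` such that `(1, r)` is a two-way distance of `G`. -/
def arcTypes (G : Digraph V) : Set ℕ :=
  {q | ∃ r, (1, r) ∈ G.twoWayDistSet ∧ q = r + 1}

/-- The underlying graph of `G` is a complete multipartite graph `K_{n_1, …, n_m}` with `m ≥ 2`
parts, all of size at least `2`. -/
def IsSemicompleteMultipartite (G : Digraph V) : Prop :=
  ∃ (m : ℕ) (n : Fin m → ℕ), 2 ≤ m ∧ (∀ i, 2 ≤ n i) ∧
    Nonempty (G.toSimpleGraphInclusive ≃g SimpleGraph.completeMultipartiteGraph fun i => Fin (n i))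

end Digraph

namespace AssocScheme

variable {X I : Type*}

/-- The number of `z` with `(x, z) ∈ R i` and `(z, y) ∈ R j`. -/
noncomputable def interCount (R : I → Set (X × X)) (i j : I) (x y : X) : ℕ :=
  Set.ncard {z | (x, z) ∈ R i ∧ (z, y) ∈ R j}

/-- The family `R` of relations on the (finite) set `X` is an association scheme. -/
structure IsScheme (R : I → Set (X × X)) : Prop where
  nonempty : ∀ i, (R i).Nonempty
  diagonal : ∃ i, R i = {p | p.1 = p.2}
  partition : ∀ p, ∃! i, p ∈ R i
  transpose : ∀ i, ∃ j, R j = {p | p.swap ∈ R i}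
  intersection : ∀ i j l, ∃ c : ℕ, ∀ x y, (x, y) ∈ R l → interCount R i j x y = c

/-- All relations are symmetric. -/
def IsSymmetric (R : I → Set (X × X)) : Prop :=
  ∀ i, ∀ x y, (x, y) ∈ R i → (y, x) ∈ R i

/-- The intersection numbers satisfy `p_{i,j}^l = p_{j,i}^l` for all `i`, `j`, `l`. -/
def IsCommutative (R : I → Set (X × X)) : Prop :=
  ∀ i j l, ∀ x y, (x, y) ∈ R l → interCount R i j x y = interCount R j i x y

end AssocScheme

namespace Digraph

variable {V : Type*}

/-- `G` is strongly connected and its two-way distance relations form a non-symmetric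
association scheme. -/
structure IsWeaklyDistanceRegular (G : Digraph V) : Prop where
  stronglyConnected : G.StronglyConnected
  isScheme : AssocScheme.IsScheme G.twoWayRel
  nonSymmetric : ¬ AssocScheme.IsSymmetric G.twoWayRel

/-- A weakly distance-regular digraph whose attached scheme is commutative. -/
structure IsCommutativeWeaklyDistanceRegular (G : Digraph V) : Prop
    extends G.IsWeaklyDistanceRegular where
  commutative : AssocScheme.IsCommutative G.twoWayRel

end Digraph

namespace Digraph

variable {V : Type*} {G : Digraph V}

/-! ### Distances -/

/-! Constant in- and out-degrees bound the return distance of an arc by 3 (`dist_le_three_of_adj`),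
so `T` lies in {2, 3, 4}. If `T` had neither 3 nor 4, all arcs would be digons and the scheme
symmetric. It remains to show that 2 and 4 do not both occur (`not_digon_and_type_one_three`).

By commutativity, the number of pairs of given types in a row or column of a pair of parts depends
only on the two parts (`partCount_eq_of_samePart`). Hence two pairs of parts sharing one type share
all their types. If digons and type (1,3) coexist, this forces (1,3) and (3,1) into the same pair of
parts (`exists_type_three_one`). A degree count then puts all digon neighbours of a vertex in one
part, and a double count of paths of length 3 shows that all vertices of a part have the same digon
neighbours. The pair of type (1,3) would then be a digon. -/

theorem HasPath.dist_le {r : ℕ} {x y : V} (h : G.HasPath r x y) : G.dist x y ≤ r :=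
  Nat.sInf_le h

theorem hasPath_zero_iff {x y : V} : G.HasPath 0 x y ↔ x = y :=
  ⟨fun ⟨_, h0, h1, _⟩ => h0.symm.trans h1, fun h => ⟨fun _ => x, rfl, h, by simp⟩⟩

theorem hasPath_succ_iff {r : ℕ} {x y : V} :
    G.HasPath (r + 1) x y ↔ ∃ z, G.Adj x z ∧ G.HasPath r z y := by
  constructor
  · rintro ⟨w, h0, h1, h⟩
    refine ⟨w 1, ?_, fun t => w (t + 1), rfl, h1, fun t ht => h (t + 1) (by omega)⟩
    have := h 0 (by omega)
    rwa [h0] at this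
  · rintro ⟨z, hz, w, h0, h1, h⟩
    refine ⟨fun t => Nat.casesOn t x w, rfl, h1, ?_⟩
    intro t ht
    cases t with
    | zero => simpa [h0] using hz
    | succ t => exact h t (by omega)

theorem hasPath_one_iff {x y : V} : G.HasPath 1 x y ↔ G.Adj x y := by
  simp [hasPath_succ_iff, hasPath_zero_iff]

theorem HasPath.reverse (hs : ∀ x y, G.Adj x y → G.Adj y x) {r : ℕ} {x y : V}
    (h : G.HasPath r x y) : G.HasPath r y x := by
  obtain ⟨w, h0, h1, h⟩ := h
  refine ⟨fun t => w (r - t), by simpa using h1, by simpa using h0, fun t ht => hs _ _ ?_⟩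
  have := h (r - (t + 1)) (by omega)
  rwa [show r - (t + 1) + 1 = r - t by omega] at this

theorem dist_comm_of_symm (hs : ∀ x y, G.Adj x y → G.Adj y x) (x y : V) :
    G.dist x y = G.dist y x := by
  unfold dist
  congr 1
  ext r
  exact ⟨HasPath.reverse hs, HasPath.reverse hs⟩

theorem dist_self (x : V) : G.dist x x = 0 :=
  Nat.le_zero.1 (hasPath_zero_iff.2 rfl).dist_le

theorem StronglyConnected.hasPath_dist (h : G.StronglyConnected) (x y : V) :
    G.HasPath (G.dist x y) x y :=
  Nat.sInf_mem (h x y)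

theorem StronglyConnected.dist_eq_zero_iff (h : G.StronglyConnected) {x y : V} :
    G.dist x y = 0 ↔ x = y := by
  refine ⟨fun h0 => ?_, fun e => e ▸ dist_self x⟩
  have := h.hasPath_dist x y
  rwa [h0, hasPath_zero_iff] at this

theorem StronglyConnected.dist_eq_one_iff (h : G.StronglyConnected)
    (hloop : ∀ x, ¬ G.Adj x x) {x y : V} : G.dist x y = 1 ↔ G.Adj x y := by
  constructor
  · intro h1
    have := h.hasPath_dist x y
    rwa [h1, hasPath_one_iff] at this
  · intro hxy
    have h1 := (hasPath_one_iff.2 hxy).dist_le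
    have h0 : G.dist x y ≠ 0 := fun h0 => hloop x (by
      rw [h.dist_eq_zero_iff] at h0
      rwa [← h0] at hxy)
    omega

theorem dist_le_two {x y z : V} (hxz : G.Adj x z) (hzy : G.Adj z y) : G.dist x y ≤ 2 :=
  HasPath.dist_le (hasPath_succ_iff.2 ⟨z, hxz, hasPath_one_iff.2 hzy⟩)

theorem dist_le_three {x y z w : V} (hxz : G.Adj x z) (hzw : G.Adj z w) (hwy : G.Adj w y) :
    G.dist x y ≤ 3 :=
  HasPath.dist_le (hasPath_succ_iff.2 ⟨z, hxz, hasPath_succ_iff.2 ⟨w, hzw, hasPath_one_iff.2 hwy⟩⟩)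

theorem twoWayDist_eq_swap {x y : V} {a b : ℕ} (h : G.twoWayDist x y = (a, b)) :
    G.twoWayDist y x = (b, a) := by
  simp only [twoWayDist, Prod.mk.injEq] at h ⊢
  exact ⟨h.2, h.1⟩

/-! ### Counting with sets of two-way distances -/

/-- The number of `z` whose two-way distances from `x` and to `y` lie in given sets. -/
noncomputable def typeCount (G : Digraph V) (I J : Set (ℕ × ℕ)) (x y : V) : ℕ :=
  Set.ncard {z | G.twoWayDist x z ∈ I ∧ G.twoWayDist z y ∈ J}

instance [Finite V] : Finite G.twoWayDistSet := by
  refine (Set.finite_range fun p : V × V => G.twoWayDist p.1 p.2).subset ?_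
  rintro _ ⟨x, y, rfl⟩
  exact ⟨(x, y), rfl⟩

open Classical in
-- Extends the scheme axioms from single types to unions of types, such as "arc" or "same part".
theorem typeCount_eq_sum [Finite V] [Fintype G.twoWayDistSet] (I J : Set (ℕ × ℕ)) (x y : V) :
    G.typeCount I J x y = ∑ p : G.twoWayDistSet × G.twoWayDistSet,
      if p.1.1 ∈ I ∧ p.2.1 ∈ J then AssocScheme.interCount G.twoWayRel p.1 p.2 x y else 0 := by
  have := Fintype.ofFinite V
  unfold typeCount AssocScheme.interCount
  simp only [Set.ncard_eq_toFinset_card', Set.toFinset_ofPred]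
  rw [Finset.card_eq_sum_card_fiberwise (t := Finset.univ)
    (f := fun z => ((⟨G.twoWayDist x z, x, z, rfl⟩, ⟨G.twoWayDist z y, z, y, rfl⟩) :
      G.twoWayDistSet × G.twoWayDistSet)) (fun _ _ => by simp)]
  refine Finset.sum_congr rfl fun p _ => ?_
  obtain ⟨⟨i, hi⟩, ⟨j, hj⟩⟩ := p
  split_ifs with h
  · congr 1
    ext z
    simp only [Finset.mem_filter, Finset.mem_univ, true_and, Prod.mk.injEq, twoWayRel,
      Set.mem_ofPred_eq]
    grind
  · rw [Finset.card_eq_zero, Finset.filter_eq_empty_iff]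
    intro z hz
    simp only [Finset.mem_filter, Finset.mem_univ, true_and, Prod.mk.injEq] at hz ⊢
    grind

theorem IsWeaklyDistanceRegular.typeCount_congr [Finite V] (h : G.IsWeaklyDistanceRegular)
    (I J : Set (ℕ × ℕ)) {x y x' y' : V} (hxy : G.twoWayDist x y = G.twoWayDist x' y') :
    G.typeCount I J x y = G.typeCount I J x' y' := by
  classical
  have := Fintype.ofFinite G.twoWayDistSet
  rw [typeCount_eq_sum, typeCount_eq_sum]
  refine Finset.sum_congr rfl fun p _ => ?_
  obtain ⟨c, hc⟩ := h.isScheme.intersection p.1 p.2 ⟨G.twoWayDist x y, x, y, rfl⟩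
  rw [hc x y rfl, hc x' y' hxy.symm]

theorem IsCommutativeWeaklyDistanceRegular.typeCount_comm [Finite V]
    (h : G.IsCommutativeWeaklyDistanceRegular) (I J : Set (ℕ × ℕ)) (x y : V) :
    G.typeCount I J x y = G.typeCount J I x y := by
  classical
  have := Fintype.ofFinite G.twoWayDistSet
  rw [typeCount_eq_sum, typeCount_eq_sum, ← (Equiv.prodComm _ _).sum_comp]
  refine Finset.sum_congr rfl fun p _ => ?_
  simp only [Equiv.prodComm_apply, Prod.fst_swap, Prod.snd_swap, and_comm]
  rw [h.commutative _ _ ⟨G.twoWayDist x y, x, y, rfl⟩ x y rfl]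
  congr

/-! ### Degrees -/

theorem IsWeaklyDistanceRegular.ncard_congr [Finite V] (h : G.IsWeaklyDistanceRegular)
    (I : Set (ℕ × ℕ)) (x y : V) :
    {z | G.twoWayDist x z ∈ I}.ncard = {z | G.twoWayDist y z ∈ I}.ncard := by
  have := h.typeCount_congr I Set.univ (x := x) (y := x) (x' := y) (y' := y)
    (by simp [twoWayDist, dist_self])
  simpa [typeCount] using this

/-! ### Non-adjacency -/

/-- `x` and `y` are equal or non-adjacent in the underlying graph. -/
def SamePart (G : Digraph V) (x y : V) : Prop := ¬ G.Adj x y ∧ ¬ G.Adj y x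

theorem SamePart.symm {x y : V} (h : G.SamePart x y) : G.SamePart y x := ⟨h.2, h.1⟩

theorem SamePart.refl (hloop : ∀ x, ¬ G.Adj x x) (x : V) : G.SamePart x x := ⟨hloop x, hloop x⟩

theorem IsSemicompleteMultipartite.samePart_trans (hloop : ∀ x, ¬ G.Adj x x)
    (h : G.IsSemicompleteMultipartite) {x y z : V} (hxy : G.SamePart x y)
    (hyz : G.SamePart y z) : G.SamePart x z := by
  obtain ⟨m, n, -, -, ⟨e⟩⟩ := h
  have key : ∀ a b, G.SamePart a b ↔ (e a).1 = (e b).1 := by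
    intro a b
    have := e.map_rel_iff (a := a) (b := b)
    simp only [toSimpleGraphInclusive, SimpleGraph.fromRel_adj, SimpleGraph.comap_adj,
      SimpleGraph.top_adj] at this
    refine not_iff_not.1 (Iff.trans ?_ this.symm)
    rw [SamePart, ← not_or, not_not]
    refine ⟨fun hab => ⟨?_, hab⟩, And.right⟩
    rintro rfl
    exact hloop a (or_self_iff.1 hab)
  rw [key] at *
  exact hxy.trans hyz

/-- `G` is a loopless commutative weakly distance-regular digraph in which being non-adjacent is
transitive. -/
structure IsMultipartiteRegular (G : Digraph V) : Prop where
  loopless : ∀ x, ¬ G.Adj x x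
  regular : G.IsCommutativeWeaklyDistanceRegular
  trans : ∀ {x y z}, G.SamePart x y → G.SamePart y z → G.SamePart x z

/-- The number of `z` in the part of `y` whose two-way distance from `x` lies in `I`. -/
noncomputable def partCount (G : Digraph V) (I : Set (ℕ × ℕ)) (x y : V) : ℕ :=
  Set.ncard {z | G.twoWayDist x z ∈ I ∧ G.SamePart z y}

/-! ### Counting within parts, and the possible arc types -/

namespace IsMultipartiteRegular

theorem adj_iff (h : G.IsMultipartiteRegular) {x y : V} :
    G.Adj x y ↔ (G.twoWayDist x y).1 = 1 :=
  (h.regular.stronglyConnected.dist_eq_one_iff h.loopless).symm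

theorem adj_iff' (h : G.IsMultipartiteRegular) {x y : V} :
    G.Adj y x ↔ (G.twoWayDist x y).2 = 1 :=
  (h.regular.stronglyConnected.dist_eq_one_iff h.loopless).symm

theorem digon_iff (h : G.IsMultipartiteRegular) {x y : V} :
    G.twoWayDist x y = (1, 1) ↔ G.Adj x y ∧ G.Adj y x := by
  rw [h.adj_iff, h.adj_iff' (x := x) (y := y), Prod.ext_iff]

theorem samePart_iff (h : G.IsMultipartiteRegular) {x y : V} :
    G.SamePart x y ↔ G.twoWayDist x y ∈ {i : ℕ × ℕ | i.1 ≠ 1 ∧ i.2 ≠ 1} := by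
  rw [SamePart, h.adj_iff, h.adj_iff' (x := x) (y := y)]
  rfl

theorem refl (h : G.IsMultipartiteRegular) (x : V) : G.SamePart x x := SamePart.refl h.loopless x

theorem adj_or_adj (h : G.IsMultipartiteRegular) {x y z : V} (hxy : G.SamePart x y)
    (hyz : G.Adj y z ∨ G.Adj z y) : G.Adj x z ∨ G.Adj z x := by
  by_contra hc
  have hc' : G.SamePart x z := not_or.1 hc
  have := h.trans hxy.symm hc'
  exact not_or.2 this hyz

theorem samePart_or (x y : V) : G.SamePart x y ∨ G.Adj x y ∨ G.Adj y x := by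
  unfold SamePart; tauto

theorem partCount_eq_typeCount (h : G.IsMultipartiteRegular) (I : Set (ℕ × ℕ)) (x y : V) :
    G.partCount I x y = G.typeCount I {i | i.1 ≠ 1 ∧ i.2 ≠ 1} x y := by
  simp only [partCount, typeCount, h.samePart_iff]

variable [Finite V]

theorem ncard_out (h : G.IsMultipartiteRegular) (x y : V) :
    {z | G.Adj x z}.ncard = {z | G.Adj y z}.ncard := by
  simpa only [h.adj_iff, Set.mem_ofPred_eq] using h.regular.ncard_congr {i | i.1 = 1} x y

theorem ncard_in (h : G.IsMultipartiteRegular) (x y : V) :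
    {z | G.Adj z x}.ncard = {z | G.Adj z y}.ncard := by
  have hx := h.regular.ncard_congr {i | i.2 = 1} x y
  have e : ∀ a b, (G.twoWayDist a b).2 = 1 ↔ G.Adj b a := fun a b => h.adj_iff'.symm
  simpa only [Set.mem_ofPred_eq, e] using hx

theorem exists_digon (h : G.IsMultipartiteRegular) {a b : V} (hab : G.twoWayDist a b = (1, 1))
    (x : V) : ∃ u, G.twoWayDist x u = (1, 1) := by
  have hx := h.regular.ncard_congr {(1, 1)} x a
  have ha : {z | G.twoWayDist a z ∈ ({(1, 1)} : Set (ℕ × ℕ))}.ncard ≠ 0 :=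
    Set.ncard_ne_zero_of_mem (a := b) hab
  rw [← hx] at ha
  exact Set.nonempty_of_ncard_ne_zero ha

theorem partCount_eq_ncard (h : G.IsMultipartiteRegular) (I : Set (ℕ × ℕ)) (x y : V) :
    G.partCount I x y = {w | G.SamePart x w ∧ G.twoWayDist w y ∈ I}.ncard := by
  rw [h.partCount_eq_typeCount, h.regular.typeCount_comm]
  simp only [typeCount, h.samePart_iff]

theorem partCount_congr (h : G.IsMultipartiteRegular) (I : Set (ℕ × ℕ)) {x y x' y' : V}
    (hxy : G.twoWayDist x y = G.twoWayDist x' y') :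
    G.partCount I x y = G.partCount I x' y' := by
  rw [h.partCount_eq_typeCount, h.partCount_eq_typeCount, h.regular.typeCount_congr _ _ hxy]

/-- The row count sees only the part of `y`; by commutativity it equals the column count, which sees
only the part of `x`. -/
theorem partCount_eq_of_samePart (h : G.IsMultipartiteRegular) (I : Set (ℕ × ℕ)) {x y x' y' : V}
    (hx : G.SamePart x x') (hy : G.SamePart y y') :
    G.partCount I x y = G.partCount I x' y' := by
  have h1 : G.partCount I x y = G.partCount I x y' := by
    unfold partCount
    congr 1
    ext z
    exact and_congr_right fun _ => ⟨fun hz => h.trans hz hy, fun hz => h.trans hz hy.symm⟩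
  rw [h1, h.partCount_eq_ncard, h.partCount_eq_ncard]
  congr 1
  ext z
  exact and_congr_left fun _ => ⟨fun hz => h.trans hx.symm hz, fun hz => h.trans hx hz⟩

/-- If the pair of parts of `(x, y)` contains a pair of type `i`, then so does the pair of parts
of every `(a, b)` of the same type as `(x, y)`, in every row and every column. -/
theorem exists_of_type_eq (h : G.IsMultipartiteRegular) {x y x' y' a b : V} {i : ℕ × ℕ}
    (hx : G.SamePart x x') (hy : G.SamePart y y') (hi : G.twoWayDist x' y' = i)
    (hab : G.twoWayDist a b = G.twoWayDist x y) :
    (∃ z, G.SamePart z b ∧ G.twoWayDist a z = i) ∧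
      ∃ w, G.SamePart w a ∧ G.twoWayDist w b = i := by
  have h0 : G.partCount {i} x' y' ≠ 0 :=
    Set.ncard_ne_zero_of_mem (a := y') ⟨hi, h.refl y'⟩
  rw [← h.partCount_eq_of_samePart {i} hx hy, ← h.partCount_congr {i} hab] at h0
  constructor
  · obtain ⟨z, hz, hzb⟩ := Set.nonempty_of_ncard_ne_zero h0
    exact ⟨z, hzb, hz⟩
  · rw [h.partCount_eq_ncard] at h0
    obtain ⟨w, hw, hwb⟩ := Set.nonempty_of_ncard_ne_zero h0
    exact ⟨w, hw.symm, hwb⟩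

/-- Without a path of length 2 from `z` to `x`, each out-neighbour of `z` must be one of `x`, and
each in-neighbour of `x` one of `z`; equal degrees turn the inclusions into equalities. -/
theorem adj_iff_of_no_two_path (h : G.IsMultipartiteRegular) {x z : V} (hxz : G.SamePart x z)
    (hno : ∀ u, G.Adj z u → ¬ G.Adj u x) :
    (∀ u, G.Adj z u ↔ G.Adj x u) ∧ (∀ u, G.Adj u x ↔ G.Adj u z) ∧
      ∀ u, G.Adj x u → ¬ G.Adj u x := by
  have h1 : {u | G.Adj z u} = {u | G.Adj x u} := by
    refine Set.eq_of_subset_of_ncard_le (fun u hu => ?_) (h.ncard_out _ _).le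
    exact (h.adj_or_adj hxz (Or.inl hu)).resolve_right (hno u hu)
  have h1' : ∀ u, G.Adj z u ↔ G.Adj x u := fun u => Set.ext_iff.1 h1 u
  have h2 : {u | G.Adj u x} = {u | G.Adj u z} := by
    refine Set.eq_of_subset_of_ncard_le (fun u hu => ?_) (h.ncard_in _ _).le
    exact (h.adj_or_adj hxz.symm (Or.inr hu)).resolve_left fun hzu => hno u hzu hu
  exact ⟨h1', fun u => Set.ext_iff.1 h2 u, fun u hu => hno u ((h1' u).2 hu)⟩

theorem dist_le_three_of_adj (h : G.IsMultipartiteRegular) {x y : V} (hxy : G.Adj x y) :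
    G.dist y x ≤ 3 := by
  by_contra! hd
  -- Otherwise `x` and `y` have the same out-neighbours, and `y` has a loop. This `z` falls in the
  -- part of `x`.
  obtain ⟨z, hyz, hz⟩ : ∃ z, G.Adj y z ∧ ¬ G.Adj x z := by
    by_contra! hc
    have : {z | G.Adj y z} = {z | G.Adj x z} :=
      Set.eq_of_subset_of_ncard_le hc (h.ncard_out _ _).le
    exact h.loopless y ((Set.ext_iff.1 this y).2 hxy)
  have hzx : ¬ G.Adj z x := fun hzx => by
    have := dist_le_two hyz hzx
    omega
  have hno : ∀ u, G.Adj z u → ¬ G.Adj u x := fun u hzu hux => by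
    have := dist_le_three hyz hzu hux
    omega
  obtain ⟨h1, h2, -⟩ := h.adj_iff_of_no_two_path ⟨hz, hzx⟩ hno
  exact hno y ((h1 y).2 hxy) ((h2 y).2 hyz)

theorem adj_cases (h : G.IsMultipartiteRegular) {x y : V} (hxy : G.Adj x y) :
    G.twoWayDist x y = (1, 1) ∨ G.twoWayDist x y = (1, 2) ∨ G.twoWayDist x y = (1, 3) := by
  have h1 : G.dist x y = 1 := (h.regular.stronglyConnected.dist_eq_one_iff h.loopless).2 hxy
  have h3 := h.dist_le_three_of_adj hxy
  have h0 : G.dist y x ≠ 0 := fun h0 => by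
    rw [h.regular.stronglyConnected.dist_eq_zero_iff] at h0
    exact h.loopless x (by rwa [h0] at hxy)
  simp only [twoWayDist, Prod.mk.injEq]
  omega

theorem dist_eq_two (h : G.IsMultipartiteRegular) {a b : V} (hab : G.twoWayDist a b = (1, 1))
    {x z : V} (hxz : G.SamePart x z) (hne : x ≠ z) : G.dist z x = 2 := by
  obtain ⟨u, hu⟩ := h.exists_digon hab x
  rw [h.digon_iff] at hu
  have h2 : G.dist z x ≤ 2 := by
    by_contra! hd
    refine (h.adj_iff_of_no_two_path hxz fun u hzu hux => ?_).2.2 u hu.1 hu.2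
    have := dist_le_two hzu hux
    omega
  have hs := h.regular.stronglyConnected
  have h0 : G.dist z x ≠ 0 := fun h0 => hne (hs.dist_eq_zero_iff.1 h0).symm
  have h1 : G.dist z x ≠ 1 := fun h1 => hxz.2 ((hs.dist_eq_one_iff h.loopless).1 h1)
  omega

theorem twoWayDist_eq_two_two (h : G.IsMultipartiteRegular) {a b : V}
    (hab : G.twoWayDist a b = (1, 1)) {x z : V} (hxz : G.SamePart x z) (hne : x ≠ z) :
    G.twoWayDist x z = (2, 2) := by
  rw [twoWayDist, h.dist_eq_two hab hxz hne, h.dist_eq_two hab hxz.symm hne.symm]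

end IsMultipartiteRegular

/-- Both sides count the pairs `(u, w)` with steps `x, u, w, y` of types in `I`, `J`, `K`. -/
theorem sum_typeCount_assoc [Fintype V] (I J K : Set (ℕ × ℕ)) [DecidablePred (· ∈ I)]
    [DecidablePred (· ∈ K)] (x y : V) :
    ∑ u with G.twoWayDist x u ∈ I, G.typeCount J K u y =
      ∑ w with G.twoWayDist w y ∈ K, G.typeCount I J x w := by
  classical
  have e : ∀ (I J : Set (ℕ × ℕ)) (x y : V), G.typeCount I J x y =
      ∑ z with G.twoWayDist x z ∈ I ∧ G.twoWayDist z y ∈ J, 1 := by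
    intro I J x y
    rw [Finset.sum_const, smul_eq_mul, mul_one, typeCount, Set.ncard_eq_toFinset_card',
      Set.toFinset_ofPred]
  simp only [e]
  refine Finset.sum_comm' fun u w => ?_
  simp only [Finset.mem_filter, Finset.mem_univ, true_and]
  tauto

/-! ### Digons and arcs of type (1,3) exclude each other -/

namespace IsMultipartiteRegular

theorem not_adj_of_dist_eq_three {x y z : V} (hxy : G.twoWayDist x y = (1, 3))
    (hyz : G.Adj y z) : ¬ G.Adj z x := fun hzx => by
  have h3 : G.dist y x = 3 := (Prod.ext_iff.1 hxy).2
  have := dist_le_two hyz hzx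
  omega

variable [Finite V]

/-- No path of length 2 leads from `y` to `x`, so the out-neighbours of `y` outside the part of `x`
are out-neighbours of `x`, neither joined to `x` by digons nor in the part of `y`. Compare with the
common out-degree. -/
theorem digon_count_le (h : G.IsMultipartiteRegular) {x y : V}
    (hxy : G.twoWayDist x y = (1, 3)) :
    {z | G.twoWayDist x z ∈ ({(1, 1)} : Set (ℕ × ℕ))}.ncard + G.partCount {i | i.1 = 1} x y ≤
      G.partCount {i | i.1 = 1} y x + G.partCount {(1, 1)} x y := by
  set A := {z | G.Adj y z}
  set B := {z | G.Adj x z}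
  set D := {z | G.twoWayDist x z ∈ ({(1, 1)} : Set (ℕ × ℕ))}
  set P := {z | G.SamePart z x}
  set Q := {z | G.SamePart z y}
  have hf : G.partCount {i | i.1 = 1} x y = (B ∩ Q).ncard := by
    unfold partCount
    congr 1
    ext z
    exact and_congr_left fun _ => h.adj_iff.symm
  have hf' : G.partCount {i | i.1 = 1} y x = (A ∩ P).ncard := by
    unfold partCount
    congr 1
    ext z
    exact and_congr_left fun _ => h.adj_iff.symm
  have hDB : ∀ z ∈ D, G.Adj x z ∧ G.Adj z x := fun z hz => h.digon_iff.1 hz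
  have hg : G.partCount {(1, 1)} x y = (D ∩ (B ∩ Q)).ncard := by
    unfold partCount
    congr 1
    ext z
    exact ⟨fun hz => ⟨hz.1, (hDB z hz.1).1, hz.2⟩, fun hz => ⟨hz.1, hz.2.2⟩⟩
  have hsub : A \ P ⊆ B \ (D ∪ (B ∩ Q)) := by
    rintro z ⟨hyz, hzP⟩
    have hzx := not_adj_of_dist_eq_three hxy hyz
    have hxz : G.Adj x z := by
      by_contra hxz
      exact hzP ⟨hzx, hxz⟩
    refine ⟨hxz, ?_⟩
    rintro (hz | hz)
    · exact hzx (hDB z hz).2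
    · exact hz.2.2 hyz
  have h1 := Set.ncard_le_ncard hsub
  have h2 := Set.ncard_inter_add_ncard_sdiff_eq_ncard A P
  have h3 : (B \ (D ∪ (B ∩ Q))).ncard + (D ∪ (B ∩ Q)).ncard = B.ncard :=
    Set.ncard_sdiff_add_ncard_of_subset
      (Set.union_subset (fun z hz => (hDB z hz).1) Set.inter_subset_left)
  have h4 := Set.ncard_union_add_ncard_inter D (B ∩ Q)
  have h5 : A.ncard = B.ncard := h.ncard_out y x
  omega

/-- If both digons and arcs of type `(1, 3)` occur, then a pair of parts containing a pair of type
`(1, 3)` also contains one of type `(3, 1)`. -/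
theorem exists_type_three_one (h : G.IsMultipartiteRegular) {a b : V}
    (hab : G.twoWayDist a b = (1, 1)) {x y : V} (hxy : G.twoWayDist x y = (1, 3)) :
    ∃ x' y', G.SamePart x x' ∧ G.SamePart y y' ∧ G.twoWayDist y' x' = (1, 3) := by
  by_contra! hno
  have hr := h.refl
  -- A digon has the same type in both directions, so it would transfer (1,3) to the reversed pair
  -- of parts.
  have hnd : ∀ x' y', G.SamePart x x' → G.SamePart y y' → G.twoWayDist x' y' ≠ (1, 1) := by
    intro x' y' hx hy hd
    obtain ⟨⟨z, hz, hz'⟩, -⟩ := h.exists_of_type_eq hx.symm hy.symm hxy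
      ((twoWayDist_eq_swap hd).trans hd.symm)
    exact hno z y' (h.trans hx hz.symm) hy hz'
  obtain ⟨z₀, hz₀y, hxz₀⟩ : ∃ z, G.SamePart z y ∧ G.twoWayDist x z = (2, 1) := by
    have hle := h.digon_count_le hxy
    have hg : G.partCount {(1, 1)} x y = 0 := by
      rw [partCount, Set.ncard_eq_zero, Set.eq_empty_iff_forall_notMem]
      exact fun z hz => hnd x z (hr x) hz.2.symm hz.1
    have hf : G.partCount {i | i.1 = 1} x y ≠ 0 :=
      Set.ncard_ne_zero_of_mem (a := y) ⟨by simp [hxy], hr y⟩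
    have hf' : G.partCount {i | i.1 = 1} y x ≠ 0 := by omega
    rw [h.partCount_eq_ncard] at hf'
    obtain ⟨z, hyz, hzx⟩ := Set.nonempty_of_ncard_ne_zero hf'
    refine ⟨z, hyz.symm, ?_⟩
    rcases h.adj_cases (h.adj_iff.2 hzx) with hz | hz | hz
    · exact absurd (twoWayDist_eq_swap hz) (hnd x z (hr x) hyz)
    · exact twoWayDist_eq_swap hz
    · exact absurd hz (hno x z (hr x) hyz)
  obtain ⟨u, hxu⟩ := h.exists_digon hab x
  have hux := twoWayDist_eq_swap hxu
  -- Any other arc type here also occurs, in some direction, between the parts of `x` and `y`, and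
  -- would carry the digon there.
  have hall : ∀ u', G.SamePart u u' → G.twoWayDist x u' = (1, 1) := by
    intro u' hu
    have hxu' := h.adj_or_adj hu.symm (Or.inr (h.digon_iff.1 hxu).1)
    rcases hxu'.symm with had | had <;> rcases h.adj_cases had with ht | ht | ht
    · exact ht
    · obtain ⟨⟨z, hz, hz'⟩, -⟩ := h.exists_of_type_eq hu.symm (hr x) hux
        (hxz₀.trans (twoWayDist_eq_swap ht).symm)
      exact absurd hz' (hnd x z (hr x) (h.trans hz₀y.symm hz.symm))
    · obtain ⟨⟨z, hz, hz'⟩, -⟩ := h.exists_of_type_eq (hr x) hu.symm hxu (hxy.trans ht.symm)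
      exact absurd hz' (hnd x z (hr x) hz.symm)
    · exact twoWayDist_eq_swap ht
    · obtain ⟨⟨z, hz, hz'⟩, -⟩ := h.exists_of_type_eq (hr x) hu.symm hxu
        (hxz₀.trans (twoWayDist_eq_swap ht).symm)
      exact absurd hz' (hnd x z (hr x) (h.trans hz₀y.symm hz.symm))
    · obtain ⟨⟨z, hz, hz'⟩, -⟩ := h.exists_of_type_eq hu.symm (hr x) hux (hxy.trans ht.symm)
      exact absurd hz' (hnd x z (hr x) hz.symm)
  have hyu : ∀ u', G.SamePart u u' → ¬ G.Adj y u' := fun u' hu hyu' =>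
    not_adj_of_dist_eq_three hxy hyu' (h.digon_iff.1 (hall u' hu)).2
  have huy : G.Adj u y := by
    rcases samePart_or (G := G) u y with hs | hs | hs
    · exact absurd hxu (hnd x u (hr x) hs.symm)
    · exact hs
    · exact absurd hs (hyu u (hr u))
  -- Each type gives an arc from `y` into the part of `u`: directly for a digon, otherwise by
  -- transfer from the parts of `x` and `y`, which contain both (1,3) and (2,1).
  rcases h.adj_cases huy with ht | ht | ht
  · exact hyu u (hr u) (h.digon_iff.1 ht).2
  · obtain ⟨⟨z, hz, hz'⟩, -⟩ := h.exists_of_type_eq (hr x) hz₀y hxy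
      ((twoWayDist_eq_swap ht).trans hxz₀.symm)
    exact hyu z hz.symm (h.adj_iff.2 (by rw [hz']))
  · obtain ⟨-, w, hw, hw'⟩ := h.exists_of_type_eq (hr x) hz₀y.symm hxz₀ (ht.trans hxy.symm)
    exact hyu w hw.symm (h.adj_iff'.2 (by rw [hw']))

theorem not_digon_and_type_one_three (h : G.IsMultipartiteRegular) {a b : V}
    (hab : G.twoWayDist a b = (1, 1)) {x y : V} (hxy : G.twoWayDist x y = (1, 3)) : False := by
  classical
  have := Fintype.ofFinite V
  obtain ⟨x', y', hx, hy, ht⟩ := h.exists_type_three_one hab hxy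
  have hsymm : ∀ I, G.partCount I y x = G.partCount I x y := fun I =>
    (h.partCount_eq_of_samePart I hy hx).trans (h.partCount_congr I (ht.trans hxy.symm))
  -- all vertices joined to `x` by digons lie in one part
  have hle := h.digon_count_le hxy
  rw [hsymm, add_comm, Nat.add_le_add_iff_left] at hle
  have hpart : ∀ c d, {z | G.twoWayDist c z ∈ ({(1, 1)} : Set (ℕ × ℕ))}.ncard ≤
      G.partCount {(1, 1)} c d → ∀ u, G.twoWayDist c u = (1, 1) → G.SamePart u d := by
    intro c d hcd u hu
    have he := Set.eq_of_subset_of_ncard_le (fun z hz => hz.1) hcd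
    exact ((Set.ext_iff.1 he u).2 hu).2
  have hxQ := hpart x y hle
  obtain ⟨u, hxu⟩ := h.exists_digon hab x
  have huy := hxQ u hxu
  have hdigon : ∀ c d e, G.twoWayDist c d = (1, 1) → G.twoWayDist c e = (1, 1) →
      G.SamePart e d := by
    intro c d e hcd hce
    refine hpart c d ?_ e hce
    rw [h.regular.ncard_congr {(1, 1)} c x, h.partCount_congr {(1, 1)} (hcd.trans hxu.symm),
      h.partCount_eq_of_samePart {(1, 1)} (h.refl x) huy]
    exact hle
  -- common digon neighbours
  have ha : ∀ w, ¬ G.SamePart w x → G.typeCount {(1, 1)} {(1, 1)} x w = 0 := by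
    intro w hw
    rw [typeCount, Set.ncard_eq_zero, Set.eq_empty_iff_forall_notMem]
    rintro v ⟨hxv, hvw⟩
    exact hw (hdigon v x w (twoWayDist_eq_swap hxv) hvw)
  obtain ⟨⟨w₀, hw₀, hyw₀⟩, -⟩ := h.exists_of_type_eq hy hx ht (rfl : G.twoWayDist y x = _)
  have hw₀x : w₀ ≠ x := by
    rintro rfl
    rw [twoWayDist_eq_swap hyw₀] at hxy
    simp at hxy
  set l := G.typeCount {(1, 1)} {(1, 1)} x w₀
  have hal : ∀ w, G.SamePart w x → w ≠ x → G.typeCount {(1, 1)} {(1, 1)} x w = l := by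
    intro w hw hwx
    refine h.regular.typeCount_congr _ _ ?_
    rw [h.twoWayDist_eq_two_two hab hw.symm hwx.symm,
      h.twoWayDist_eq_two_two hab hw₀.symm hw₀x.symm]
  have hax : G.typeCount {(1, 1)} {(1, 1)} x x =
      {z | G.twoWayDist x z ∈ ({(1, 1)} : Set (ℕ × ℕ))}.ncard := by
    unfold typeCount
    congr 1
    ext z
    exact ⟨fun hz => hz.1, fun hz => ⟨hz, twoWayDist_eq_swap hz⟩⟩
  -- two ways of counting
  obtain ⟨K₁, hK₁⟩ : ∃ K : Set (ℕ × ℕ), K = {(1, 3)} := ⟨_, rfl⟩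
  obtain ⟨K₂, hK₂⟩ : ∃ K : Set (ℕ × ℕ), K = {(3, 1)} := ⟨_, rfl⟩
  -- Digon neighbours `v` of `x` are at distance (2,2) from `y`, a symmetric type, so commutativity
  -- allows (1,3) and (3,1) to be exchanged in the last step.
  have hsum : ∑ w with G.twoWayDist w y ∈ K₁,
        G.typeCount {(1, 1)} {(1, 1)} x w =
      ∑ w with G.twoWayDist w y ∈ K₂,
        G.typeCount {(1, 1)} {(1, 1)} x w := by
    refine ((sum_typeCount_assoc {(1, 1)} {(1, 1)} K₁ x y).symm.trans ?_).trans
      (sum_typeCount_assoc {(1, 1)} {(1, 1)} K₂ x y)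
    refine Finset.sum_congr rfl fun v hv => ?_
    have hxv : G.twoWayDist x v = (1, 1) := (Finset.mem_filter.1 hv).2
    have hvy := hxQ v hxv
    have hne : v ≠ y := by
      rintro rfl
      rw [hxv] at hxy
      simp at hxy
    have h22 : G.twoWayDist v y = G.twoWayDist y v := by
      rw [h.twoWayDist_eq_two_two hab hvy hne, h.twoWayDist_eq_two_two hab hvy.symm hne.symm]
    rw [h.regular.typeCount_congr _ _ h22, h.regular.typeCount_comm, hK₁, hK₂]
    unfold typeCount
    congr 1
    ext w
    exact ⟨fun hw => ⟨twoWayDist_eq_swap hw.2, twoWayDist_eq_swap hw.1⟩,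
      fun hw => ⟨twoWayDist_eq_swap hw.2, twoWayDist_eq_swap hw.1⟩⟩
  have hrestrict : ∀ K : Set (ℕ × ℕ), ∑ w with G.twoWayDist w y ∈ K,
        G.typeCount {(1, 1)} {(1, 1)} x w =
      ∑ w with G.SamePart x w ∧ G.twoWayDist w y ∈ K, G.typeCount {(1, 1)} {(1, 1)} x w := by
    intro K
    symm
    refine Finset.sum_subset (fun w hw => ?_) fun w hw hw' => ha w fun hs => hw' ?_
    · simp only [Finset.mem_filter] at hw ⊢
      exact ⟨hw.1, hw.2.2⟩
    · simp only [Finset.mem_filter] at hw ⊢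
      exact ⟨hw.1, hs.symm, hw.2⟩
  have hcard : ∀ K : Set (ℕ × ℕ),
      (Finset.univ.filter fun w => G.SamePart x w ∧ G.twoWayDist w y ∈ K).card =
        G.partCount K x y := by
    intro K
    rw [h.partCount_eq_ncard, Set.ncard_eq_toFinset_card', Set.toFinset_ofPred]
  have hcount : G.partCount K₂ x y = G.partCount K₁ x y := by
    rw [← hsymm K₁, h.partCount_eq_ncard, hK₁, hK₂]
    unfold partCount
    congr 1
    ext w
    exact ⟨fun hw => ⟨twoWayDist_eq_swap hw.2, hw.1.symm⟩,
      fun hw => ⟨hw.2.symm, twoWayDist_eq_swap hw.1⟩⟩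
  have hxm : x ∈ Finset.univ.filter fun w => G.SamePart x w ∧
      G.twoWayDist w y ∈ K₁ :=
    Finset.mem_filter.2 ⟨Finset.mem_univ _, h.refl x, hK₁ ▸ hxy⟩
  have hpos : 0 < G.partCount K₁ x y := by
    rw [← hcard]
    exact Finset.card_pos.2 ⟨x, hxm⟩
  -- With `n` terms on each side and `x` occurring only on the left, `hsum` reads k + (n - 1)l = nl,
  -- where k is the digon degree.
  have hkl : G.typeCount {(1, 1)} {(1, 1)} x x = l := by
    rw [hrestrict, hrestrict, ← Finset.add_sum_erase _ _ hxm,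
      Finset.sum_const_nat (m := l) (s := Finset.erase _ _),
      Finset.sum_const_nat (m := l), Finset.card_erase_of_mem hxm, hcard, hcard, hcount] at hsum
    · obtain ⟨n, hn⟩ := Nat.exists_eq_succ_of_ne_zero hpos.ne'
      rw [hn, Nat.succ_sub_one, Nat.succ_mul] at hsum
      omega
    · intro w hw
      obtain ⟨-, hxw, hwy⟩ := Finset.mem_filter.1 hw
      refine hal w hxw.symm ?_
      rintro rfl
      rw [hK₂, Set.mem_singleton_iff, hxy] at hwy
      simp at hwy
    · intro w hw
      obtain ⟨hwx, hw⟩ := Finset.mem_erase.1 hw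
      exact hal w (Finset.mem_filter.1 hw).2.1.symm hwx
  have hwu : ∀ w, G.SamePart x w → G.twoWayDist w u = (1, 1) := by
    intro w hw
    by_cases hwx : w = x
    · rwa [hwx]
    have he : {z | G.twoWayDist x z ∈ ({(1, 1)} : Set (ℕ × ℕ)) ∧
        G.twoWayDist z w ∈ ({(1, 1)} : Set (ℕ × ℕ))} =
        {z | G.twoWayDist x z ∈ ({(1, 1)} : Set (ℕ × ℕ))} := by
      refine Set.eq_of_subset_of_ncard_le (fun z hz => hz.1) ?_
      rw [← hax, hkl, ← hal w hw.symm hwx]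
      rfl
    exact twoWayDist_eq_swap ((Set.ext_iff.1 he u).2 hxu).2
  -- The column of `u` consists of digons only; `y` lies in the part of `u`, so its column has
  -- equally many.
  have hP : {w | G.SamePart x w ∧ G.twoWayDist w y ∈ ({(1, 1)} : Set (ℕ × ℕ))} =
      {w | G.SamePart x w ∧ G.twoWayDist w u ∈ ({(1, 1)} : Set (ℕ × ℕ))} := by
    refine Set.eq_of_subset_of_ncard_le (fun w hw => ⟨hw.1, hwu w hw.1⟩) ?_
    rw [← h.partCount_eq_ncard, ← h.partCount_eq_ncard,
      h.partCount_eq_of_samePart {(1, 1)} (h.refl x) huy]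
  have hd : G.twoWayDist x y = (1, 1) := ((Set.ext_iff.1 hP x).2 ⟨h.refl x, hxu⟩).2
  rw [hd] at hxy
  simp at hxy

end IsMultipartiteRegular

end Digraph

/-! ### The classification of `T` -/

theorem proposition5p1 {V : Type*} [Finite V] (G : Digraph V)
    (hloop : ∀ x, ¬ G.Adj x x)
    (hwdr : G.IsCommutativeWeaklyDistanceRegular)
    (hmp : G.IsSemicompleteMultipartite) :
    (G.arcTypes = {3} ∨ G.arcTypes = {4} ∨ G.arcTypes = {3, 4} ∨ G.arcTypes = {2, 3}) ∧
      G.arcTypes ≠ {2, 4} ∧ G.arcTypes ≠ {2, 3, 4} := by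
  have h : G.IsMultipartiteRegular := ⟨hloop, hwdr, hmp.samePart_trans hloop⟩
  have hsub : ∀ q ∈ G.arcTypes, q = 2 ∨ q = 3 ∨ q = 4 := by
    rintro _ ⟨r, ⟨x, y, hxy⟩, rfl⟩
    have := h.adj_cases (h.adj_iff.2 (by rw [hxy]))
    simp only [hxy, Prod.mk.injEq, true_and] at this
    omega
  have h24 : ¬ (2 ∈ G.arcTypes ∧ 4 ∈ G.arcTypes) := by
    rintro ⟨⟨r, ⟨a, b, hab⟩, hr⟩, ⟨s, ⟨x, y, hxy⟩, hs⟩⟩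
    obtain rfl : r = 1 := by omega
    obtain rfl : s = 3 := by omega
    exact h.not_digon_and_type_one_three hab hxy
  have h34 : 3 ∈ G.arcTypes ∨ 4 ∈ G.arcTypes := by
    by_contra! hc
    refine hwdr.nonSymmetric fun i x y hxy => ?_
    have hs : ∀ a b, G.Adj a b → G.Adj b a := by
      intro a b hab
      rcases h.adj_cases hab with ht | ht | ht
      · exact (h.digon_iff.1 ht).2
      · exact absurd ⟨2, ⟨a, b, ht⟩, rfl⟩ hc.1
      · exact absurd ⟨3, ⟨a, b, ht⟩, rfl⟩ hc.2
    have hd := Digraph.dist_comm_of_symm hs x y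
    have hi : G.twoWayDist x y = i := hxy
    change G.twoWayDist y x = i
    rw [← hi, Digraph.twoWayDist, Digraph.twoWayDist, hd]
  have hext : ∀ S : Set ℕ, (∀ q ∈ S, q = 2 ∨ q = 3 ∨ q = 4) →
      (2 ∈ G.arcTypes ↔ 2 ∈ S) → (3 ∈ G.arcTypes ↔ 3 ∈ S) → (4 ∈ G.arcTypes ↔ 4 ∈ S) →
      G.arcTypes = S := by
    intro S hS h2 h3 h4
    ext q
    constructor
    · intro hq
      rcases hsub q hq with rfl | rfl | rfl
      exacts [h2.1 hq, h3.1 hq, h4.1 hq]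
    · intro hq
      rcases hS q hq with rfl | rfl | rfl
      exacts [h2.2 hq, h3.2 hq, h4.2 hq]
  refine ⟨?_, fun e => h24 (by simp [e]), fun e => h24 (by simp [e])⟩
  by_cases h2 : 2 ∈ G.arcTypes
  · have h4 : 4 ∉ G.arcTypes := fun h4 => h24 ⟨h2, h4⟩
    have h3 := h34.resolve_right h4
    exact Or.inr <| Or.inr <| Or.inr <| hext _ (by simp) (by simp [h2]) (by simp [h3])
      (by simp [h4])
  · by_cases h3 : 3 ∈ G.arcTypes <;> by_cases h4 : 4 ∈ G.arcTypes
    · exact Or.inr <| Or.inr <| Or.inl <| hext _ (by simp) (by simp [h2]) (by simp [h3])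
        (by simp [h4])
    · exact Or.inl <| hext _ (by simp) (by simp [h2]) (by simp [h3]) (by simp [h4])
    · exact Or.inr <| Or.inl <| hext _ (by simp) (by simp [h2]) (by simp [h3]) (by simp [h4])
    · exact absurd h34 (by tauto)
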